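/- All graphs are finite and simple. A visibility representation of a graph $G$ assigns to every vertex $v$ of $G$ a nonempty connected region $R_v\subseteq\mathbb{R}^2$ such that the regions are pairwise disjoint and any two distinct vertices $u,v$ are adjacent in $G$ if and only if there is a sightline between $R_u$ and $R_v$, that is, a line segment with one endpoint in $R_u$ and the other in $R_v$ that intersects no region $R_w$ with $w\neq u,v$. A graph is a convex compact visibility graph if it has a visibility representation in which every region is compact and convex. Every convex compact visibility graph either is planar or contains a $K_4$ (as a subgraph). Here a graph is planar if it can be drawn in $\mathbb{R}^2$ with distinct points as vertices and simple arcs joining their endpoints as edges, such that no edge passes through a vertex other than its ends and two different edges meet at most in common ends. -/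

import Mathlib

/-- The Euclidean plane. -/
abbrev Plane : Type := EuclideanSpace ℝ (Fin 2)

/-- The segment from `x` to `y` is a sightline between the regions `R u` and `R v`: its endpoints
lie in these regions and it meets no other region (it may meet `R u` and `R v` in further
points). -/
def IsSightline {V : Type*} (R : V → Set Plane) (u v : V) (x y : Plane) : Prop :=
  x ∈ R u ∧ y ∈ R v ∧ ∀ w : V, w ≠ u → w ≠ v → Disjoint (segment ℝ x y) (R w)

/-- The regions `R v` are a visibility representation of `G`: they are nonempty, connected and
pairwise disjoint, and two different vertices are adjacent exactly if there is a sightline between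
their regions. Mathlib's `IsConnected` includes nonemptiness. -/
structure IsVisibilityRepresentation {V : Type*} (G : SimpleGraph V) (R : V → Set Plane) :
    Prop where
  isConnected : ∀ v : V, IsConnected (R v)
  disjoint : ∀ u v : V, u ≠ v → Disjoint (R u) (R v)
  adj_iff : ∀ u v : V, u ≠ v → (G.Adj u v ↔ ∃ x y : Plane, IsSightline R u v x y)

/-- Convex compact visibility graphs. -/
def IsConvexCompactVisibilityGraph {V : Type*} (G : SimpleGraph V) : Prop :=
  ∃ R : V → Set Plane, IsVisibilityRepresentation G R ∧
    (∀ v : V, IsCompact (R v)) ∧ (∀ v : V, Convex ℝ (R v))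

/-- A drawing of `G` in the plane without crossings: `p v` is the point drawn for the vertex `v`,
and `arc e` is the curve drawn for the edge `e`. Distinct vertices are drawn as distinct points,
every edge as a simple arc between its two ends that passes through no other vertex, and two
different edges meet at most in their common ends. -/
structure IsPlaneDrawing {V : Type*} (G : SimpleGraph V) (p : V → Plane)
    (arc : Sym2 V → Set Plane) : Prop where
  injective : Function.Injective p
  exists_path : ∀ u v : V, G.Adj u v →
    ∃ γ : Path (p u) (p v), Function.Injective γ ∧ Set.range γ = arc s(u, v)
  vertex_mem : ∀ e ∈ G.edgeSet, ∀ w : V, p w ∈ arc e → w ∈ e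
  inter_subset : ∀ e ∈ G.edgeSet, ∀ e' ∈ G.edgeSet, e ≠ e' →
    ∀ x ∈ arc e ∩ arc e', ∃ w : V, w ∈ e ∧ w ∈ e' ∧ p w = x

/-- `G` is planar: it can be drawn in the plane without crossings. -/
def IsPlanarGraph {V : Type*} (G : SimpleGraph V) : Prop :=
  ∃ (p : V → Plane) (arc : Sym2 V → Set Plane), IsPlaneDrawing G p arc

/-!
Suppose that `G` has a visibility representation by compact convex regions and contains no `K₄`.
The planar drawing is a dual of the Voronoi diagram of the regions.

*Edges are Voronoi adjacencies.* For two mutually visible regions `W` and `Z`, with `F` the union of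
the other regions, there is a disc that meets `W` and `Z` but not `F` (`exists_disc_of_adj`). A
sightline from `W` to `Z` is contained in a very flat ellipse with this property
(`exists_separates_of_segment`). Let the shape of the ellipse become rounder, with parameter `t`
decreasing to `0`, where ellipses are discs. The parameters for which a separating ellipse exists
form a set that is open to the left (`Separates.exists_lt`). At its infimum there is a limit conic
that separates weakly: its open interior misses `F`. Such a limit can be perturbed to a separating
conic (`exists_separates_of_weakly`), with two exceptions. It may be an ellipse whose interior
misses all regions and which touches `W`, `Z` and `F` in at least four points. Then the chords
between four such points are sightlines, and `G` contains a `K₄` (`top_isContained_of_conic`). Or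
it may be a half-plane whose boundary line touches a region between `W` and `Z`, which is
impossible for a limit of separating ellipses (`exists_conic_nonpos_of_tendsto`). So the infimum
is attained, hence equal to `0` (`exists_separates_zero`). Moving the centre of the resulting disc
gives a point whose nearest regions are exactly `W` and `Z` (`exists_equidistant_of_adj`).

*Voronoi adjacencies give a plane graph.* For every edge `uv` let `m` be such a point. The half arc
from `m` to a fixed point of `R u` first follows the segment to the nearest point of `R u` and
turns off shortly before reaching it. Apart from `m` it lies in the open Voronoi cell of `u`, so
half arcs of different vertices do not meet. Half arcs of the same vertex meet only in the chosen
point of the region, because the nearest point of a convex set is unique (`halfArc_inter_subset`).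
-/

open Filter Topology

/-! ### Quadratic polynomials with a prescribed elliptic shape -/

/-- The cross product of two plane vectors. -/
def cross (v y : Plane) : ℝ := v 0 * y 1 - v 1 * y 0

/-- The quadratic form `|u|² + t (v × u)²`, positive definite for `t ≥ 0`; its unit balls are discs
for `t = 0` and flat ellipses along the direction `v` for large `t`. -/
def ellipseForm (v : Plane) (t : ℝ) (u : Plane) : ℝ := u 0 ^ 2 + u 1 ^ 2 + t * cross v u ^ 2

/-- The quadratic polynomial `s · ellipseForm v t + g₀ y₀ + g₁ y₁ + k` with coefficient vector
`θ = (s, g₀, g₁, k)`. For `s > 0` its nonpositive set is an ellipse (a disc if `t = 0`), for `s = 0`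
a half-plane. -/
def conic (v : Plane) (t : ℝ) (θ : ℝ × ℝ × ℝ × ℝ) (y : Plane) : ℝ :=
  θ.1 * ellipseForm v t y + θ.2.1 * y 0 + θ.2.2.1 * y 1 + θ.2.2.2

lemma continuous_conic_uncurry (v : Plane) :
    Continuous fun x : ℝ × (ℝ × ℝ × ℝ × ℝ) × Plane => conic v x.1 x.2.1 x.2.2 := by
  unfold conic ellipseForm cross
  fun_prop

lemma continuous_conic (v : Plane) (t : ℝ) (θ : ℝ × ℝ × ℝ × ℝ) : Continuous (conic v t θ) := by
  unfold conic ellipseForm cross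
  fun_prop

lemma ellipseForm_pos (v : Plane) {t : ℝ} (ht : 0 ≤ t) {x y : Plane} (h : x ≠ y) :
    0 < ellipseForm v t (x - y) := by
  have h1 : 0 < (x - y) 0 ^ 2 + (x - y) 1 ^ 2 := by
    by_contra hn
    apply h
    have h0 : (x - y) 0 = 0 := by nlinarith [sq_nonneg ((x - y) 0), sq_nonneg ((x - y) 1)]
    have h1 : (x - y) 1 = 0 := by nlinarith [sq_nonneg ((x - y) 0), sq_nonneg ((x - y) 1)]
    simp only [PiLp.sub_apply] at h0 h1
    ext i
    fin_cases i
    · simpa using sub_eq_zero.mp h0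
    · simpa using sub_eq_zero.mp h1
  unfold ellipseForm
  have := mul_nonneg ht (sq_nonneg (cross v (x - y)))
  linarith

lemma ellipseForm_nonneg (v : Plane) {t : ℝ} (ht : 0 ≤ t) (u : Plane) :
    0 ≤ ellipseForm v t u := by
  unfold ellipseForm
  positivity

/-- Strict convexity of `conic` along segments, with its exact defect. -/
lemma conic_combo (v : Plane) (t : ℝ) (θ : ℝ × ℝ × ℝ × ℝ) (x y : Plane) (a : ℝ) :
    conic v t θ ((1 - a) • x + a • y) =
      (1 - a) * conic v t θ x + a * conic v t θ y
        - a * (1 - a) * (θ.1 * ellipseForm v t (x - y)) := by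
  simp only [conic, ellipseForm, cross, PiLp.add_apply, PiLp.sub_apply, PiLp.smul_apply,
    smul_eq_mul]
  ring

lemma conic_add_smul (v : Plane) (t : ℝ) (θ θ' : ℝ × ℝ × ℝ × ℝ) (η : ℝ) (y : Plane) :
    conic v t (θ + η • θ') y = conic v t θ y + η * conic v t θ' y := by
  simp only [conic, Prod.fst_add, Prod.snd_add, Prod.smul_fst, Prod.smul_snd, smul_eq_mul]
  ring

lemma conic_smul (v : Plane) (t : ℝ) (θ : ℝ × ℝ × ℝ × ℝ) (η : ℝ) (y : Plane) :
    conic v t (η • θ) y = η * conic v t θ y := by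
  simp only [conic, Prod.smul_fst, Prod.smul_snd, smul_eq_mul]
  ring

/-- The coefficients of the polynomial `y ↦ (y - c) · (y - d)` for the inner product
of `ellipseForm v t`. -/
def diameterConic (v : Plane) (t : ℝ) (c d : Plane) : ℝ × ℝ × ℝ × ℝ :=
  (1, -(c 0 + d 0) + t * v 1 * (cross v c + cross v d),
    -(c 1 + d 1) - t * v 0 * (cross v c + cross v d),
    c 0 * d 0 + c 1 * d 1 + t * cross v c * cross v d)

lemma conic_diameterConic (v : Plane) (t : ℝ) (c d y : Plane) :
    conic v t (diameterConic v t c d) y =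
      (y 0 - c 0) * (y 0 - d 0) + (y 1 - c 1) * (y 1 - d 1)
        + t * (cross v y - cross v c) * (cross v y - cross v d) := by
  simp only [conic, diameterConic, ellipseForm, cross]
  ring

lemma conic_diameterConic_self (v : Plane) (t : ℝ) (d y : Plane) :
    conic v t (diameterConic v t d d) y = ellipseForm v t (y - d) := by
  simp only [conic, diameterConic, ellipseForm, cross, PiLp.sub_apply]
  ring

lemma conic_diameterConic_combo (v : Plane) (t : ℝ) (c d : Plane) (a : ℝ) :
    conic v t (diameterConic v t c d) ((1 - a) • c + a • d) =
      -(a * (1 - a)) * ellipseForm v t (c - d) := by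
  have hs : (diameterConic v t c d).1 = 1 := rfl
  rw [conic_combo, conic_diameterConic, conic_diameterConic, hs]
  ring

/-- The coefficients of the affine function `y ↦ (d - c) × (y - c)`, whose zero set is the line
through `c` and `d`. -/
def lineConic (c d : Plane) : ℝ × ℝ × ℝ × ℝ :=
  (0, -(d 1 - c 1), d 0 - c 0, (d 1 - c 1) * c 0 - (d 0 - c 0) * c 1)

lemma conic_lineConic (v : Plane) (t : ℝ) (c d y : Plane) :
    conic v t (lineConic c d) y = cross (d - c) (y - c) := by
  simp only [conic, lineConic, cross, PiLp.sub_apply]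
  ring

lemma sq_add_sq_pos_of_ne {c d : Plane} (h : c ≠ d) :
    0 < (d 0 - c 0) ^ 2 + (d 1 - c 1) ^ 2 := by
  have := ellipseForm_pos 0 le_rfl h.symm
  simpa [ellipseForm, cross] using this

lemma exists_eq_combo_of_cross_eq_zero {c d p : Plane} (hcd : c ≠ d)
    (h : cross (d - c) (p - c) = 0) : ∃ a : ℝ, p = (1 - a) • c + a • d := by
  have hpos := sq_add_sq_pos_of_ne hcd
  simp only [cross, PiLp.sub_apply] at h
  refine ⟨((d 0 - c 0) * (p 0 - c 0) + (d 1 - c 1) * (p 1 - c 1)) /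
    ((d 0 - c 0) ^ 2 + (d 1 - c 1) ^ 2), ?_⟩
  ext i
  fin_cases i
  · simp only [PiLp.add_apply, PiLp.smul_apply, smul_eq_mul, Fin.zero_eta]
    field_simp
    linear_combination (-(d 1 - c 1)) * h
  · simp only [PiLp.add_apply, PiLp.smul_apply, smul_eq_mul, Fin.mk_one]
    field_simp
    linear_combination (d 0 - c 0) * h

lemma combo_mem_segment {x y : Plane} {a : ℝ} (h0 : 0 ≤ a) (h1 : a ≤ 1) :
    (1 - a) • x + a • y ∈ segment ℝ x y :=
  ⟨1 - a, a, by linarith, h0, by ring, rfl⟩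

lemma exists_combo_of_mem_segment {x y z : Plane} (h : z ∈ segment ℝ x y) :
    ∃ a : ℝ, 0 ≤ a ∧ a ≤ 1 ∧ z = (1 - a) • x + a • y := by
  obtain ⟨b, a, hb, ha, hab, rfl⟩ := h
  exact ⟨a, ha, by linarith, by rw [← hab]; simp⟩

/-- If a conic is nonnegative on pairwise disjoint convex regions, its open chords avoid all of
them; so four points of the regions on it give four mutually visible regions. -/
lemma top_isContained_of_conic {V : Type*} {G : SimpleGraph V} {R : V → Set Plane}
    (hR : IsVisibilityRepresentation G R) (hconv : ∀ i, Convex ℝ (R i))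
    (v : Plane) {t : ℝ} (ht : 0 ≤ t) {θ : ℝ × ℝ × ℝ × ℝ} (hs : 0 < θ.1)
    (hq : ∀ i, ∀ y ∈ R i, 0 ≤ conic v t θ y) (P : Fin 4 → Plane) (hP : Function.Injective P)
    (f : Fin 4 → V) (hf : ∀ j, P j ∈ R (f j)) (h0 : ∀ j, conic v t θ (P j) = 0) :
    SimpleGraph.IsContained (⊤ : SimpleGraph (Fin 4)) G := by
  have key : ∀ j k, j ≠ k → ∀ a : ℝ, 0 < a → a < 1 →
      conic v t θ ((1 - a) • P j + a • P k) < 0 := by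
    intro j k hjk a ha0 ha1
    rw [conic_combo, h0, h0]
    have := ellipseForm_pos v ht (hP.ne hjk)
    have : 0 < a * (1 - a) * (θ.1 * ellipseForm v t (P j - P k)) :=
      mul_pos (mul_pos ha0 (by linarith)) (mul_pos hs this)
    linarith
  have hinj : Function.Injective f := by
    intro j k hjk
    by_contra hne
    have h1 := key j k hne (1 / 2) (by norm_num) (by norm_num)
    have h2 := hq (f j) _ ((hconv (f j)).segment_subset (hf j) (hjk ▸ hf k)
      (combo_mem_segment (a := 1 / 2) (by norm_num) (by norm_num)))
    linarith
  refine ⟨⟨⟨f, ?_⟩, hinj⟩⟩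
  intro j k hjk
  have hne : j ≠ k := hjk
  rw [hR.adj_iff _ _ (hinj.ne hne)]
  refine ⟨P j, P k, hf j, hf k, fun w hwj hwk => ?_⟩
  rw [Set.disjoint_left]
  intro z hz hzw
  obtain ⟨a, ha0, ha1, rfl⟩ := exists_combo_of_mem_segment hz
  rcases ha0.eq_or_lt with rfl | ha0
  · simp only [sub_zero, one_smul, zero_smul, add_zero] at hzw
    exact Set.disjoint_left.mp (hR.disjoint _ _ hwj) hzw (hf j)
  rcases ha1.eq_or_lt with rfl | ha1
  · simp only [sub_self, one_smul, zero_smul, zero_add] at hzw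
    exact Set.disjoint_left.mp (hR.disjoint _ _ hwk) hzw (hf k)
  · exact absurd (hq w _ hzw) (not_le.mpr (key j k hne a ha0 ha1))

/-- Perturbation: if `q ≥ 0` on a compact set and `h > 0` at the zeros of `q`, then `q + η h > 0`
for all small `η > 0`. -/
lemma exists_add_mul_pos_of_isCompact {F : Set Plane} (hF : IsCompact F) {q h : Plane → ℝ}
    (hq : Continuous q) (hh : Continuous h) (hq0 : ∀ y ∈ F, 0 ≤ q y)
    (hpos : ∀ y ∈ F, q y = 0 → 0 < h y) :
    ∃ η₀ > 0, ∀ η, 0 < η → η ≤ η₀ → ∀ y ∈ F, 0 < q y + η * h y := by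
  have hF' : IsCompact (F ∩ {y | h y ≤ 0}) := hF.inter_right (isClosed_le hh continuous_const)
  rcases (F ∩ {y | h y ≤ 0}).eq_empty_or_nonempty with he | hne
  · refine ⟨1, one_pos, fun η hη _ y hy => ?_⟩
    have : 0 < h y := by
      by_contra hn
      exact (Set.eq_empty_iff_forall_notMem.mp he) y ⟨hy, not_lt.mp hn⟩
    have := mul_pos hη this
    linarith [hq0 y hy]
  · obtain ⟨y₀, hy₀, hmin⟩ := hF'.exists_isMinOn hne hq.continuousOn
    obtain ⟨y₁, hy₁, hmin'⟩ := hF'.exists_isMinOn hne hh.continuousOn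
    have hq₀ : 0 < q y₀ := by
      refine lt_of_le_of_ne (hq0 _ hy₀.1) fun h0 => ?_
      exact absurd (hpos y₀ hy₀.1 h0.symm) (not_lt.mpr hy₀.2)
    have hh₁ : h y₁ ≤ 0 := hy₁.2
    refine ⟨q y₀ / (1 - h y₁), div_pos hq₀ (by linarith), fun η hη hle y hy => ?_⟩
    by_cases hc : h y ≤ 0
    · have h1 : q y₀ ≤ q y := hmin ⟨hy, hc⟩
      have h2 : h y₁ ≤ h y := hmin' ⟨hy, hc⟩
      rw [le_div_iff₀ (by linarith)] at hle
      nlinarith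
    · have := mul_pos hη (not_le.mp hc)
      linarith [hq0 y hy]

/-- Let ellipses with points `cₙ → c` and `dₙ → d` converge to a half-plane bounded by the line
`cd`, all `cₙ` and `dₙ` lying on the line or outside the half-plane. Then every point `p` of the
open segment `cd` belongs to one of the ellipses. Indeed, the point `r` of the chord `cₙdₙ` over `p`
is reached from `p` along the outer normal of the half-plane, in which direction the `n`-th quadratic
polynomial increases, and it is nonpositive at `r`. -/
lemma exists_conic_nonpos_of_tendsto (v : Plane) {t : ℝ} {θ : ℝ × ℝ × ℝ × ℝ} {c d : Plane}
    {tn : ℕ → ℝ} {θn : ℕ → ℝ × ℝ × ℝ × ℝ} {cn dn : ℕ → Plane}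
    (ht : Tendsto tn atTop (𝓝 t)) (hθ : Tendsto θn atTop (𝓝 θ))
    (hc : Tendsto cn atTop (𝓝 c)) (hd : Tendsto dn atTop (𝓝 d))
    (htn : ∀ n, 0 ≤ tn n) (hsn : ∀ n, 0 ≤ (θn n).1)
    (hcn : ∀ n, conic v (tn n) (θn n) (cn n) ≤ 0) (hdn : ∀ n, conic v (tn n) (θn n) (dn n) ≤ 0)
    (hcn' : ∀ n, 0 ≤ conic v t θ (cn n)) (hdn' : ∀ n, 0 ≤ conic v t θ (dn n))
    (hs : θ.1 = 0) (hg : 0 < θ.2.1 ^ 2 + θ.2.2.1 ^ 2) (hcd : c ≠ d)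
    (hqc : conic v t θ c = 0) (hqd : conic v t θ d = 0) {p : Plane} {a : ℝ}
    (ha0 : 0 < a) (ha1 : a < 1) (hp : p = (1 - a) • c + a • d) :
    ∃ n, conic v (tn n) (θn n) p ≤ 0 := by
  set φ : Plane → ℝ := fun y => (d 0 - c 0) * (y 0 - p 0) + (d 1 - c 1) * (y 1 - p 1) with hφ
  have hφcont : Continuous φ := by fun_prop
  have hpos := sq_add_sq_pos_of_ne hcd
  have hp0 : p 0 = (1 - a) * c 0 + a * d 0 := by simp [hp]
  have hp1 : p 1 = (1 - a) * c 1 + a * d 1 := by simp [hp]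
  have hφc : φ c < 0 := by
    have : φ c = -(a * ((d 0 - c 0) ^ 2 + (d 1 - c 1) ^ 2)) := by
      simp only [hφ, hp0, hp1]; ring
    rw [this]
    have := mul_pos ha0 hpos
    linarith
  have hφd : 0 < φ d := by
    have : φ d = (1 - a) * ((d 0 - c 0) ^ 2 + (d 1 - c 1) ^ 2) := by
      simp only [hφ, hp0, hp1]; ring
    rw [this]
    exact mul_pos (by linarith) hpos
  -- the derivative of the `n`-th conic at `p` along the gradient of the limit
  set D : ℝ × ℝ × ℝ × ℝ × ℝ → ℝ := fun x =>
    x.2.1 * (2 * p 0 * θ.2.1 + 2 * p 1 * θ.2.2.1 + 2 * x.1 *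
      (v 0 * p 1 - v 1 * p 0) * (v 0 * θ.2.2.1 - v 1 * θ.2.1))
      + x.2.2.1 * θ.2.1 + x.2.2.2.1 * θ.2.2.1 with hD
  have hDcont : Continuous D := by fun_prop
  have hDlim : Tendsto (fun n => D (tn n, θn n)) atTop (𝓝 (D (t, θ))) :=
    (hDcont.tendsto _).comp (ht.prodMk_nhds hθ)
  have hDpos : 0 < D (t, θ) := by
    have : D (t, θ) = θ.2.1 ^ 2 + θ.2.2.1 ^ 2 := by simp only [hD, hs]; ring
    rwa [this]
  obtain ⟨n, ⟨h1, h2⟩, h3⟩ := ((((hφcont.tendsto c).comp hc).eventually_lt_const hφc).and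
    (((hφcont.tendsto d).comp hd).eventually_const_lt hφd)).and
    (hDlim.eventually_const_lt hDpos) |>.exists
  refine ⟨n, ?_⟩
  simp only [Function.comp] at h1 h2
  set A := φ (cn n) with hA
  set B := φ (dn n) with hB
  set b : ℝ := -A / (B - A) with hb
  have hBA : 0 < B - A := by linarith
  have hb0 : 0 ≤ b := div_nonneg (by linarith) hBA.le
  have hb1 : b ≤ 1 := by rw [hb, div_le_one hBA]; linarith
  set r : Plane := (1 - b) • cn n + b • dn n with hr
  have hr0 : r 0 = (1 - b) * cn n 0 + b * dn n 0 := by simp [hr]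
  have hr1 : r 1 = (1 - b) * cn n 1 + b * dn n 1 := by simp [hr]
  have hφr : (d 0 - c 0) * (r 0 - p 0) + (d 1 - c 1) * (r 1 - p 1) = 0 := by
    have e1 : (d 0 - c 0) * (r 0 - p 0) + (d 1 - c 1) * (r 1 - p 1) = (1 - b) * A + b * B := by
      simp only [hA, hB, hφ, hr0, hr1]; ring
    rw [e1, hb]
    field_simp
    ring
  have hqr : conic v (tn n) (θn n) r ≤ 0 := by
    rw [hr, conic_combo]
    have e := mul_nonneg (mul_nonneg hb0 (sub_nonneg.mpr hb1))
      (mul_nonneg (hsn n) (ellipseForm_nonneg v (htn n) (cn n - dn n)))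
    have e1 := mul_nonneg (sub_nonneg.mpr hb1) (neg_nonneg.mpr (hcn n))
    have e2 := mul_nonneg hb0 (neg_nonneg.mpr (hdn n))
    linarith
  have hqr' : 0 ≤ conic v t θ r := by
    rw [hr, conic_combo, hs]
    have e1 := mul_nonneg (sub_nonneg.mpr hb1) (hcn' n)
    have e2 := mul_nonneg hb0 (hdn' n)
    linarith
  have hqp : conic v t θ p = 0 := by rw [hp, conic_combo, hqc, hqd, hs]; ring
  have hgd : θ.2.1 * (d 0 - c 0) + θ.2.2.1 * (d 1 - c 1) = 0 := by
    have := hqd.trans hqc.symm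
    simp only [conic, hs] at this
    linarith
  set τ : ℝ := conic v t θ r / (θ.2.1 ^ 2 + θ.2.2.1 ^ 2) with hτ
  have hτ0 : 0 ≤ τ := div_nonneg hqr' hg.le
  have hgr : conic v t θ r = θ.2.1 * (r 0 - p 0) + θ.2.2.1 * (r 1 - p 1) := by
    have : conic v t θ r = conic v t θ r - conic v t θ p := by rw [hqp, sub_zero]
    rw [this]
    simp only [conic, hs]
    ring
  -- both `r - p` and the gradient are orthogonal to `d - c`
  have hperp : θ.2.1 * (r 1 - p 1) = θ.2.2.1 * (r 0 - p 0) := by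
    have e0 : (d 0 - c 0) * (θ.2.1 * (r 1 - p 1) - θ.2.2.1 * (r 0 - p 0)) = 0 := by
      linear_combination (r 1 - p 1) * hgd - θ.2.2.1 * hφr
    have e1 : (d 1 - c 1) * (θ.2.1 * (r 1 - p 1) - θ.2.2.1 * (r 0 - p 0)) = 0 := by
      linear_combination (-(r 0 - p 0)) * hgd + θ.2.1 * hφr
    rcases mul_eq_zero.mp e0 with e0 | e0
    · rcases mul_eq_zero.mp e1 with e1 | e1
      · rw [e0, e1] at hpos; norm_num at hpos
      · linarith
    · linarith
  have k0 : r 0 = p 0 + τ * θ.2.1 := by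
    rw [hτ, hgr]
    field_simp
    linear_combination θ.2.2.1 * (-hperp)
  have k1 : r 1 = p 1 + τ * θ.2.2.1 := by
    rw [hτ, hgr]
    field_simp
    linear_combination θ.2.1 * hperp
  have e : conic v (tn n) (θn n) r = conic v (tn n) (θn n) p + τ * D (tn n, θn n)
      + τ ^ 2 * ((θn n).1 * (θ.2.1 ^ 2 + θ.2.2.1 ^ 2
        + tn n * (v 0 * θ.2.2.1 - v 1 * θ.2.1) ^ 2)) := by
    simp only [conic, ellipseForm, cross, k0, k1, hD]
    ring
  have e1 := mul_nonneg hτ0 h3.le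
  have e2 : 0 ≤ τ ^ 2 * ((θn n).1 * (θ.2.1 ^ 2 + θ.2.2.1 ^ 2
        + tn n * (v 0 * θ.2.2.1 - v 1 * θ.2.1) ^ 2)) := by
    have := hsn n
    have := htn n
    positivity
  linarith

/-! ### Conics separating two compact sets from a third -/

/-- The nonpositive set of the conic with coefficients `θ` meets `W` and `Z` but not `F`. -/
def Separates (W Z F : Set Plane) (v : Plane) (t : ℝ) (θ : ℝ × ℝ × ℝ × ℝ) : Prop :=
  0 ≤ θ.1 ∧ (∃ c ∈ W, conic v t θ c ≤ 0) ∧ (∃ d ∈ Z, conic v t θ d ≤ 0) ∧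
    ∀ y ∈ F, 0 < conic v t θ y

lemma Separates.symm {W Z F : Set Plane} {v : Plane} {t : ℝ} {θ : ℝ × ℝ × ℝ × ℝ}
    (h : Separates W Z F v t θ) : Separates Z W F v t θ :=
  ⟨h.1, h.2.2.1, h.2.1, h.2.2.2⟩

/-- If the ellipse has a point of `W` in its interior, it can be shrunk around its point `d` of
`Z` so that it no longer touches `F`. -/
lemma exists_separates_of_neg {W Z F : Set Plane} {v : Plane} {t : ℝ}
    (ht : 0 ≤ t) {θ : ℝ × ℝ × ℝ × ℝ} (hs : 0 ≤ θ.1) {c d : Plane} (hc : c ∈ W) (hd : d ∈ Z)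
    (hdF : d ∉ F) (hqc : conic v t θ c < 0) (hqd : conic v t θ d ≤ 0)
    (hq : ∀ y ∈ F, 0 ≤ conic v t θ y) : ∃ θ', Separates W Z F v t θ' := by
  have hE := ellipseForm_nonneg v ht (c - d)
  set η : ℝ := -conic v t θ c / (ellipseForm v t (c - d) + 1) with hη
  have hη0 : 0 < η := div_pos (by linarith) (by linarith)
  refine ⟨θ + η • diameterConic v t d d, ?_, ⟨c, hc, ?_⟩, ⟨d, hd, ?_⟩, fun y hy => ?_⟩
  · simp only [Prod.fst_add, Prod.smul_fst, diameterConic, smul_eq_mul, mul_one]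
    linarith
  · rw [conic_add_smul, conic_diameterConic_self]
    have : η * (ellipseForm v t (c - d) + 1) = -conic v t θ c := by
      rw [hη]; field_simp
    nlinarith
  · rw [conic_add_smul, conic_diameterConic]
    linarith
  · rw [conic_add_smul, conic_diameterConic_self]
    have hyd : y ≠ d := fun h => hdF (h ▸ hy)
    have := mul_pos hη0 (ellipseForm_pos v ht hyd)
    linarith [hq y hy]

/-- A conic that weakly separates `W` and `Z` from `F` can be perturbed to a separating one unless
it is an ellipse that is tangent to `W` and `Z` and touches `F` twice, or a half-plane whose
boundary line touches `F` between points of `W` and `Z`. -/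
lemma exists_separates_of_weakly {W Z F : Set Plane} (hF : IsCompact F)
    (hWZ : Disjoint W Z) (hWF : Disjoint W F) (hZF : Disjoint Z F) {v : Plane} {t : ℝ}
    (ht : 0 ≤ t) {θ : ℝ × ℝ × ℝ × ℝ} (hθ : θ ≠ 0) (hs : 0 ≤ θ.1) {c d : Plane} (hc : c ∈ W)
    (hd : d ∈ Z) (hqc : conic v t θ c ≤ 0) (hqd : conic v t θ d ≤ 0)
    (hq : ∀ y ∈ F, 0 ≤ conic v t θ y)
    (hell : 0 < θ.1 → (∀ y ∈ W, 0 ≤ conic v t θ y) → (∀ y ∈ Z, 0 ≤ conic v t θ y) →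
      ∀ p ∈ F, ∀ p' ∈ F, conic v t θ p = 0 → conic v t θ p' = 0 → p = p')
    (hline : θ.1 = 0 → (∀ y ∈ W, 0 ≤ conic v t θ y) → (∀ y ∈ Z, 0 ≤ conic v t θ y) →
      0 < θ.2.1 ^ 2 + θ.2.2.1 ^ 2 →
      ∀ a : ℝ, 0 < a → a < 1 → (1 - a) • c + a • d ∉ F) :
    ∃ θ', Separates W Z F v t θ' := by
  have hcF := Set.disjoint_left.mp hWF hc
  have hdF := Set.disjoint_left.mp hZF hd
  by_cases hW : ∃ y ∈ W, conic v t θ y < 0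
  · obtain ⟨y, hy, hqy⟩ := hW
    exact exists_separates_of_neg ht hs hy hd hdF hqy hqd hq
  by_cases hZ : ∃ y ∈ Z, conic v t θ y < 0
  · obtain ⟨y, hy, hqy⟩ := hZ
    obtain ⟨θ', h⟩ := exists_separates_of_neg ht hs hy hc hcF hqy hqc hq
    exact ⟨θ', h.symm⟩
  push Not at hW hZ
  have hqc0 : conic v t θ c = 0 := le_antisymm hqc (hW c hc)
  have hqd0 : conic v t θ d = 0 := le_antisymm hqd (hZ d hd)
  have hcd : c ≠ d := fun h => Set.disjoint_left.mp hWZ hc (h ▸ hd)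
  -- a perturbation that vanishes at `c` and `d` and is positive where `F` touches the conic
  suffices h : ∃ θ' : ℝ × ℝ × ℝ × ℝ, 0 ≤ θ'.1 ∧ conic v t θ' c = 0 ∧ conic v t θ' d = 0 ∧
      ∀ y ∈ F, conic v t θ y = 0 → 0 < conic v t θ' y by
    obtain ⟨θ', hs', hc', hd', hpos⟩ := h
    obtain ⟨η, hη, hηF⟩ := exists_add_mul_pos_of_isCompact hF (continuous_conic v t θ)
      (continuous_conic v t θ') hq hpos
    refine ⟨θ + η • θ', ?_, ⟨c, hc, ?_⟩, ⟨d, hd, ?_⟩, fun y hy => ?_⟩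
    · simp only [Prod.fst_add, Prod.smul_fst, smul_eq_mul]
      have := mul_nonneg hη.le hs'
      linarith
    · rw [conic_add_smul, hc', hqc0]; simp
    · rw [conic_add_smul, hd', hqd0]; simp
    · rw [conic_add_smul]
      exact hηF η hη le_rfl y hy
  have hcombo : ∀ a : ℝ, conic v t θ ((1 - a) • c + a • d) =
      -(a * (1 - a) * (θ.1 * ellipseForm v t (c - d))) := fun a => by
    rw [conic_combo, hqc0, hqd0]; ring
  rcases hs.eq_or_lt with hs0 | hs0
  · have hg : 0 < θ.2.1 ^ 2 + θ.2.2.1 ^ 2 := by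
      refine lt_of_le_of_ne (by positivity) fun h0 => hθ ?_
      have h1 : θ.2.1 = 0 := by nlinarith [sq_nonneg θ.2.1, sq_nonneg θ.2.2.1]
      have h2 : θ.2.2.1 = 0 := by nlinarith [sq_nonneg θ.2.1, sq_nonneg θ.2.2.1]
      have h3 : θ.2.2.2 = 0 := by
        have := hqc0
        simp only [conic, ← hs0, h1, h2] at this
        linarith
      exact Prod.ext hs0.symm (Prod.ext h1 (Prod.ext h2 h3))
    refine ⟨diameterConic v t c d, by simp [diameterConic], ?_, ?_, fun p hp hqp => ?_⟩
    · rw [conic_diameterConic]; ring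
    · rw [conic_diameterConic]; ring
    have hcross : cross (d - c) (p - c) = 0 := by
      have e1 : θ.2.1 * (p 0 - c 0) + θ.2.2.1 * (p 1 - c 1) = 0 := by
        have := hqp.trans hqc0.symm
        simp only [conic, ← hs0] at this
        linarith
      have e2 : θ.2.1 * (d 0 - c 0) + θ.2.2.1 * (d 1 - c 1) = 0 := by
        have := hqd0.trans hqc0.symm
        simp only [conic, ← hs0] at this
        linarith
      have f1 : θ.2.1 * cross (d - c) (p - c) = 0 := by
        simp only [cross, PiLp.sub_apply]
        linear_combination (p 1 - c 1) * e2 - (d 1 - c 1) * e1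
      have f2 : θ.2.2.1 * cross (d - c) (p - c) = 0 := by
        simp only [cross, PiLp.sub_apply]
        linear_combination (d 0 - c 0) * e1 - (p 0 - c 0) * e2
      by_contra hne
      rw [mul_eq_zero, or_iff_left hne] at f1 f2
      rw [f1, f2] at hg
      norm_num at hg
    obtain ⟨a, rfl⟩ := exists_eq_combo_of_cross_eq_zero hcd hcross
    rw [conic_diameterConic_combo]
    have hE := ellipseForm_pos v ht hcd
    have ha : a < 0 ∨ 1 < a := by
      by_contra hn
      push Not at hn
      rcases hn.1.eq_or_lt with rfl | h0
      · simp only [sub_zero, one_smul, zero_smul, add_zero] at hp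
        exact hcF hp
      rcases hn.2.eq_or_lt with rfl | h1
      · simp only [sub_self, one_smul, zero_smul, zero_add] at hp
        exact hdF hp
      exact hline hs0.symm hW hZ hg a h0 h1 hp
    have : 0 < -(a * (1 - a)) := by
      rcases ha with ha | ha <;> nlinarith
    exact mul_pos this hE
  · have hline_ne : ∀ p ∈ F, conic v t θ p = 0 → cross (d - c) (p - c) ≠ 0 := by
      intro p hp hqp h0
      obtain ⟨a, rfl⟩ := exists_eq_combo_of_cross_eq_zero hcd h0
      rw [hcombo] at hqp
      have := mul_pos hs0 (ellipseForm_pos v ht hcd)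
      have h1 : a * (1 - a) = 0 := by
        rcases mul_eq_zero.mp (neg_eq_zero.mp hqp) with h | h
        · exact h
        · exact absurd h this.ne'
      rcases mul_eq_zero.mp h1 with h | h
      · subst h
        simp only [sub_zero, one_smul, zero_smul, add_zero] at hp
        exact hcF hp
      · have h : a = 1 := by linarith
        subst h
        simp only [sub_self, one_smul, zero_smul, zero_add] at hp
        exact hdF hp
    obtain ⟨σ, hσ⟩ : ∃ σ : ℝ, ∀ p ∈ F, conic v t θ p = 0 →
        0 < σ * cross (d - c) (p - c) := by
      by_cases hex : ∃ p ∈ F, conic v t θ p = 0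
      · obtain ⟨p, hp, hqp⟩ := hex
        refine ⟨cross (d - c) (p - c), fun p' hp' hqp' => ?_⟩
        rw [hell hs0 hW hZ p' hp' p hp hqp' hqp]
        exact mul_self_pos.mpr (hline_ne p hp hqp)
      · push Not at hex
        exact ⟨0, fun p hp hqp => absurd hqp (hex p hp)⟩
    refine ⟨σ • lineConic c d, by simp [lineConic], ?_, ?_, fun p hp hqp => ?_⟩
    · rw [conic_smul, conic_lineConic]; simp [cross]
    · rw [conic_smul, conic_lineConic]; simp only [cross]; ring
    · rw [conic_smul, conic_lineConic]
      exact hσ p hp hqp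

/-- A separating ellipse stays separating when it is made slightly rounder. -/
lemma Separates.exists_lt {W Z F : Set Plane} (hF : IsCompact F) {v : Plane} {t : ℝ} (ht : 0 < t)
    {θ : ℝ × ℝ × ℝ × ℝ} (h : Separates W Z F v t θ) :
    ∃ t', 0 ≤ t' ∧ t' < t ∧ Separates W Z F v t' θ := by
  obtain ⟨hs, ⟨c, hc, hqc⟩, ⟨d, hd, hqd⟩, hq⟩ := h
  have hrew : ∀ η y, conic v (t - η) θ y =
      conic v t θ y + η * -(θ.1 * cross v y ^ 2) := fun η y => by
    simp only [conic, ellipseForm]; ring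
  obtain ⟨η, hη, hηF⟩ := exists_add_mul_pos_of_isCompact hF (continuous_conic v t θ)
    (h := fun y => -(θ.1 * cross v y ^ 2)) (by unfold cross; fun_prop)
    (fun y hy => (hq y hy).le) (fun y hy h0 => absurd h0 (hq y hy).ne')
  have hη' : 0 < min η t := lt_min hη ht
  have hle : ∀ y, conic v t θ y ≤ 0 → conic v (t - min η t) θ y ≤ 0 := fun y hy => by
    rw [hrew]
    have := mul_nonneg hη'.le (mul_nonneg hs (sq_nonneg (cross v y)))
    linarith
  refine ⟨t - min η t, by linarith [min_le_right η t], by linarith, hs, ⟨c, hc, hle c hqc⟩,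
    ⟨d, hd, hle d hqd⟩, fun y hy => ?_⟩
  rw [hrew]
  exact hηF _ hη' (min_le_left _ _) y hy

/-- A segment that avoids `F` is contained in a flat ellipse that avoids `F`. -/
lemma exists_separates_of_segment {W Z F : Set Plane} (hF : IsCompact F) {c d : Plane}
    (hc : c ∈ W) (hd : d ∈ Z) (hcd : c ≠ d) (h : Disjoint (segment ℝ c d) F) :
    ∃ t, 0 ≤ t ∧ ∃ θ, Separates W Z F (d - c) t θ := by
  obtain ⟨η, hη, hηF⟩ := exists_add_mul_pos_of_isCompact hF
    (q := fun y => cross (d - c) (y - c) ^ 2)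
    (h := conic (d - c) 0 (diameterConic (d - c) 0 c d))
    (by unfold cross; fun_prop) (continuous_conic _ _ _) (fun y _ => sq_nonneg _) (by
      intro p hp h0
      obtain ⟨a, rfl⟩ := exists_eq_combo_of_cross_eq_zero hcd (pow_eq_zero_iff two_ne_zero |>.mp h0)
      rw [conic_diameterConic_combo]
      have hE := ellipseForm_pos (d - c) le_rfl hcd
      have ha : a < 0 ∨ 1 < a := by
        by_contra hn
        push Not at hn
        exact Set.disjoint_left.mp h (combo_mem_segment hn.1 hn.2) hp
      have : 0 < -(a * (1 - a)) := by
        rcases ha with ha | ha <;> nlinarith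
      exact mul_pos this hE)
  have hcr : cross (d - c) d = cross (d - c) c := by
    simp only [cross, PiLp.sub_apply]; ring
  have hval : ∀ y, conic (d - c) (1 / η) (diameterConic (d - c) (1 / η) c d) y =
      (1 / η) * (cross (d - c) (y - c) ^ 2 +
        η * conic (d - c) 0 (diameterConic (d - c) 0 c d) y) := fun y => by
    rw [conic_diameterConic, conic_diameterConic, hcr]
    simp only [cross, PiLp.sub_apply]
    field_simp
    ring
  refine ⟨1 / η, by positivity, diameterConic (d - c) (1 / η) c d, by simp [diameterConic],
    ⟨c, hc, ?_⟩, ⟨d, hd, ?_⟩, fun y hy => ?_⟩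
  · rw [conic_diameterConic]; apply le_of_eq; ring
  · rw [conic_diameterConic]; apply le_of_eq; ring
  · rw [hval]
    exact mul_pos (by positivity) (hηF η hη le_rfl y hy)

lemma Separates.normalize {W Z F : Set Plane} (hne : F.Nonempty) {v : Plane} {t : ℝ}
    {θ : ℝ × ℝ × ℝ × ℝ} (h : Separates W Z F v t θ) :
    ∃ θ' ∈ Metric.sphere (0 : ℝ × ℝ × ℝ × ℝ) 1, Separates W Z F v t θ' := by
  obtain ⟨hs, ⟨c, hc, hqc⟩, ⟨d, hd, hqd⟩, hq⟩ := h
  have hθ : θ ≠ 0 := by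
    rintro rfl
    obtain ⟨y, hy⟩ := hne
    have := hq y hy
    simp [conic] at this
  have hpos : 0 < ‖θ‖⁻¹ := inv_pos.mpr (norm_pos_iff.mpr hθ)
  refine ⟨‖θ‖⁻¹ • θ, ?_, ?_, ⟨c, hc, ?_⟩, ⟨d, hd, ?_⟩, fun y hy => ?_⟩
  · rw [mem_sphere_zero_iff_norm, norm_smul, norm_inv, norm_norm,
      inv_mul_cancel₀ (norm_ne_zero_iff.mpr hθ)]
  · simp only [Prod.smul_fst, smul_eq_mul]
    exact mul_nonneg hpos.le hs
  · rw [conic_smul]; exact mul_nonpos_of_nonneg_of_nonpos hpos.le hqc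
  · rw [conic_smul]; exact mul_nonpos_of_nonneg_of_nonpos hpos.le hqd
  · rw [conic_smul]; exact mul_pos hpos (hq y hy)

/-- The least `t` for which some ellipse of shape `t` separates is attained, provided that no
ellipse can be tangent to `W` and `Z` and touch `F` twice while its interior is empty. -/
lemma exists_separates_zero {W Z F : Set Plane} (hW : IsCompact W) (hZ : IsCompact Z)
    (hF : IsCompact F) (hne : F.Nonempty) (hWZ : Disjoint W Z) (hWF : Disjoint W F)
    (hZF : Disjoint Z F) {v : Plane}
    (hstart : ∃ t, 0 ≤ t ∧ ∃ θ, Separates W Z F v t θ)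
    (hell : ∀ t, 0 ≤ t → ∀ θ : ℝ × ℝ × ℝ × ℝ, 0 < θ.1 → ∀ c ∈ W, ∀ d ∈ Z, conic v t θ c = 0 →
      conic v t θ d = 0 → (∀ y ∈ W, 0 ≤ conic v t θ y) → (∀ y ∈ Z, 0 ≤ conic v t θ y) →
      (∀ y ∈ F, 0 ≤ conic v t θ y) →
      ∀ p ∈ F, ∀ p' ∈ F, conic v t θ p = 0 → conic v t θ p' = 0 → p = p') :
    ∃ θ, Separates W Z F v 0 θ := by
  set T : Set ℝ := {t | 0 ≤ t ∧ ∃ θ, Separates W Z F v t θ} with hT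
  have hTne : T.Nonempty := hstart
  have hTb : BddBelow T := ⟨0, fun t ht => ht.1⟩
  have hmem : sInf T ∈ T := by
    obtain ⟨tn, -, htn, htT⟩ := exists_seq_tendsto_sInf hTne hTb
    have hsep := fun n => (htT n).2.choose_spec.normalize hne
    choose θn hθn hsepn using hsep
    choose hsn hcn hdn hqn using hsepn
    choose cn hcnW hqcn using hcn
    choose dn hdnZ hqdn using hdn
    obtain ⟨⟨θ, c, d⟩, ⟨hθ, hc, hd⟩, φ, hφ, hlim⟩ :=
      ((isCompact_sphere (0 : ℝ × ℝ × ℝ × ℝ) 1).prod (hW.prod hZ)).tendsto_subseq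
        (x := fun n => (θn n, cn n, dn n)) (fun n => ⟨hθn n, hcnW n, hdnZ n⟩)
    have hlimt := htn.comp hφ.tendsto_atTop
    have hlimθ : Tendsto (fun n => θn (φ n)) atTop (𝓝 θ) :=
      (continuous_fst.tendsto _).comp hlim
    have hlimc : Tendsto (fun n => cn (φ n)) atTop (𝓝 c) :=
      ((continuous_fst.comp continuous_snd).tendsto _).comp hlim
    have hlimd : Tendsto (fun n => dn (φ n)) atTop (𝓝 d) :=
      ((continuous_snd.comp continuous_snd).tendsto _).comp hlim
    have hlimq : ∀ {yn : ℕ → Plane} {y : Plane}, Tendsto yn atTop (𝓝 y) →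
        Tendsto (fun n => conic v (tn (φ n)) (θn (φ n)) (yn n)) atTop
          (𝓝 (conic v (sInf T) θ y)) := fun hy =>
      ((continuous_conic_uncurry v).tendsto (sInf T, θ, _)).comp
        (hlimt.prodMk_nhds (hlimθ.prodMk_nhds hy))
    have ht0 : 0 ≤ sInf T := le_csInf hTne fun t ht => ht.1
    have hθ0 : θ ≠ 0 := by
      rintro rfl
      simp at hθ
    have hs : 0 ≤ θ.1 :=
      ge_of_tendsto' ((continuous_fst.tendsto _).comp hlimθ) fun n => hsn (φ n)
    have hqc := le_of_tendsto' (hlimq hlimc) fun n => hqcn (φ n)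
    have hqd := le_of_tendsto' (hlimq hlimd) fun n => hqdn (φ n)
    have hq : ∀ y ∈ F, 0 ≤ conic v (sInf T) θ y := fun y hy =>
      ge_of_tendsto' (hlimq tendsto_const_nhds) fun n => (hqn (φ n) y hy).le
    refine ⟨ht0, exists_separates_of_weakly hF hWZ hWF hZF ht0 hθ0 hs hc hd hqc hqd hq
      (fun hs' hW' hZ' => hell _ ht0 θ hs' c hc d hd (le_antisymm hqc (hW' c hc))
        (le_antisymm hqd (hZ' d hd)) hW' hZ' hq) ?_⟩
    intro hs0 hW' hZ' hg a ha0 ha1 hp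
    obtain ⟨n, hn⟩ := exists_conic_nonpos_of_tendsto v hlimt hlimθ hlimc hlimd
      (fun n => (htT (φ n)).1) (fun n => hsn (φ n)) (fun n => hqcn (φ n)) (fun n => hqdn (φ n))
      (fun n => hW' _ (hcnW (φ n))) (fun n => hZ' _ (hdnZ (φ n))) hs0 hg
      (fun h => Set.disjoint_left.mp hWZ hc (h ▸ hd))
      (le_antisymm hqc (hW' c hc)) (le_antisymm hqd (hZ' d hd)) ha0 ha1 rfl
    exact absurd (hqn (φ n) _ hp) (not_lt.mpr hn)
  rcases hmem.1.eq_or_lt with h0 | h0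
  · rw [h0]
    exact hmem.2
  · obtain ⟨θ, hθ⟩ := hmem.2
    obtain ⟨t', ht'0, ht', hsep⟩ := hθ.exists_lt hF h0
    exact absurd (csInf_le hTb ⟨ht'0, θ, hsep⟩) (not_le.mpr ht')

/-- A separating conic of shape `t = 0` gives a separating disc; a half-plane is replaced by a
large disc. -/
lemma Separates.exists_disc {W Z F : Set Plane} (hF : IsCompact F) {v : Plane}
    {θ : ℝ × ℝ × ℝ × ℝ} (h : Separates W Z F v 0 θ) :
    ∃ o : Plane, ∃ c ∈ W, ∃ d ∈ Z, ∀ y ∈ F, dist o c < dist o y ∧ dist o d < dist o y := by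
  obtain ⟨hs, ⟨c, hc, hqc⟩, ⟨d, hd, hqd⟩, hq⟩ := h
  set C : ℝ := max (ellipseForm v 0 c) (ellipseForm v 0 d) with hC
  set θ₁ : ℝ × ℝ × ℝ × ℝ := (1, 0, 0, -C) with hθ₁
  have hθ₁v : ∀ y, conic v 0 θ₁ y = ellipseForm v 0 y - C := fun y => by
    simp only [conic, hθ₁]; ring
  obtain ⟨η, hη, hηF⟩ := exists_add_mul_pos_of_isCompact hF (continuous_conic v 0 θ)
    (continuous_conic v 0 θ₁) (fun y hy => (hq y hy).le)
    (fun y hy h0 => absurd h0 (hq y hy).ne')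
  have hsη : 0 < θ.1 + η := by linarith
  set o : Plane := !₂[-θ.2.1 / (2 * (θ.1 + η)), -θ.2.2.1 / (2 * (θ.1 + η))] with ho
  have ho0 : o 0 = -θ.2.1 / (2 * (θ.1 + η)) := by simp [ho]
  have ho1 : o 1 = -θ.2.2.1 / (2 * (θ.1 + η)) := by simp [ho]
  have hval : ∀ y, dist o y ^ 2 = (conic v 0 θ y + η * conic v 0 θ₁ y) / (θ.1 + η) +
      (o 0 ^ 2 + o 1 ^ 2 - (θ.2.2.2 - η * C) / (θ.1 + η)) := fun y => by
    rw [dist_eq_norm, EuclideanSpace.real_norm_sq_eq, Fin.sum_univ_two]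
    simp only [PiLp.sub_apply, hθ₁v]
    simp only [conic, ellipseForm, ho0, ho1]
    field_simp
    ring
  have key : ∀ x, conic v 0 θ x ≤ 0 → ellipseForm v 0 x ≤ C → ∀ y ∈ F, dist o x < dist o y := by
    intro x hx hxC y hy
    refine lt_of_pow_lt_pow_left₀ 2 dist_nonneg ?_
    rw [hval, hval]
    have h1 : conic v 0 θ x + η * conic v 0 θ₁ x ≤ 0 := by
      rw [hθ₁v]
      have := mul_nonneg hη.le (sub_nonneg.mpr hxC)
      linarith
    have h2 := div_pos (hηF η hη le_rfl y hy) hsη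
    have h3 := div_nonpos_of_nonpos_of_nonneg h1 hsη.le
    linarith
  exact ⟨o, c, hc, d, hd, fun y hy =>
    ⟨key c hqc (le_max_left _ _) y hy, key d hqd (le_max_right _ _) y hy⟩⟩

/-! ### Visible regions have adjacent Voronoi cells -/

/-- Without a `K₄`, two mutually visible regions are met by a disc that misses all others: `o` is
its centre, and its radius is the larger of the distances to `c` and `d`. -/
lemma exists_disc_of_adj {V : Type*} [Finite V] {G : SimpleGraph V} {R : V → Set Plane}
    (hR : IsVisibilityRepresentation G R) (hcomp : ∀ i, IsCompact (R i))
    (hconv : ∀ i, Convex ℝ (R i))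
    (hK : ¬ SimpleGraph.IsContained (⊤ : SimpleGraph (Fin 4)) G) {w z : V} (hwz : G.Adj w z) :
    ∃ o : Plane, ∃ c ∈ R w, ∃ d ∈ R z, ∀ i, i ≠ w → i ≠ z → ∀ y ∈ R i,
      dist o c < dist o y ∧ dist o d < dist o y := by
  set F : Set Plane := ⋃ i ∈ {i | i ≠ w ∧ i ≠ z}, R i with hFdef
  have hFmem : ∀ {y}, y ∈ F ↔ ∃ i, (i ≠ w ∧ i ≠ z) ∧ y ∈ R i := by
    intro y; simp [hFdef]
  have hF : IsCompact F := (Set.toFinite _).isCompact_biUnion fun i _ => hcomp i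
  obtain ⟨c, d, hc, hd, hcd⟩ := (hR.adj_iff w z hwz.ne).mp hwz
  rcases F.eq_empty_or_nonempty with he | hne
  · refine ⟨c, c, hc, d, hd, fun i hiw hiz y hy => ?_⟩
    exact absurd (hFmem.mpr ⟨i, ⟨hiw, hiz⟩, hy⟩) (Set.eq_empty_iff_forall_notMem.mp he y)
  have hWZ := hR.disjoint w z hwz.ne
  have hWF : Disjoint (R w) F := Set.disjoint_left.mpr fun y hy hyF => by
    obtain ⟨i, hi, hyi⟩ := hFmem.mp hyF
    exact Set.disjoint_left.mp (hR.disjoint _ _ hi.1) hyi hy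
  have hZF : Disjoint (R z) F := Set.disjoint_left.mpr fun y hy hyF => by
    obtain ⟨i, hi, hyi⟩ := hFmem.mp hyF
    exact Set.disjoint_left.mp (hR.disjoint _ _ hi.2) hyi hy
  have hne' : c ≠ d := fun h => Set.disjoint_left.mp hWZ hc (h ▸ hd)
  have hseg : Disjoint (segment ℝ c d) F := Set.disjoint_left.mpr fun y hy hyF => by
    obtain ⟨i, hi, hyi⟩ := hFmem.mp hyF
    exact Set.disjoint_left.mp (hcd i hi.1 hi.2) hy hyi
  obtain ⟨θ, hθ⟩ := exists_separates_zero (hcomp w) (hcomp z) hF hne hWZ hWF hZF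
    (exists_separates_of_segment hF hc hd hne' hseg) (by
      intro t ht θ hs a ha b hb hqa hqb hqW hqZ hqF p hp p' hp' hqp hqp'
      by_contra hpp
      obtain ⟨e, -, hpe⟩ := hFmem.mp hp
      obtain ⟨f, -, hpf⟩ := hFmem.mp hp'
      have hab : a ≠ b := fun h => Set.disjoint_left.mp hWZ ha (h ▸ hb)
      have hap : a ≠ p := fun h => Set.disjoint_left.mp hWF ha (h ▸ hp)
      have hap' : a ≠ p' := fun h => Set.disjoint_left.mp hWF ha (h ▸ hp')
      have hbp : b ≠ p := fun h => Set.disjoint_left.mp hZF hb (h ▸ hp)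
      have hbp' : b ≠ p' := fun h => Set.disjoint_left.mp hZF hb (h ▸ hp')
      refine hK (top_isContained_of_conic hR hconv (d - c) ht hs (fun i y hy => ?_)
        ![a, b, p, p'] ?_ ![w, z, e, f] ?_ ?_)
      · by_cases hiw : i = w
        · exact hqW y (hiw ▸ hy)
        by_cases hiz : i = z
        · exact hqZ y (hiz ▸ hy)
        exact hqF y (hFmem.mpr ⟨i, ⟨hiw, hiz⟩, hy⟩)
      · rw [← List.nodup_ofFn]
        simp [hab, hap, hap', hbp, hbp', hpp]
      · intro j
        fin_cases j
        exacts [ha, hb, hpe, hpf]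
      · intro j
        fin_cases j
        exacts [hqa, hqb, hqp, hqp'])
  obtain ⟨o, c', hc', d', hd', ho⟩ := hθ.exists_disc hF
  exact ⟨o, c', hc', d', hd', fun i hiw hiz y hy => ho y (hFmem.mpr ⟨i, ⟨hiw, hiz⟩, hy⟩)⟩

/-- Moving the centre of a disc straight towards its point `d` of the farther set keeps the disc
through `d` inside the original one, until both sets are equally far. -/
lemma exists_infDist_eq_of_le {A B : Set Plane} {o d : Plane} (hd : d ∈ B)
    (hle : Metric.infDist o A ≤ Metric.infDist o B) :
    ∃ m, Metric.infDist m A = Metric.infDist m B ∧ dist o m + dist m d = dist o d := by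
  set γ : ℝ → Plane := fun s => AffineMap.lineMap o d s with hγ
  have hγc : Continuous γ := AffineMap.lineMap_continuous
  have hcont : Continuous fun s => Metric.infDist (γ s) A - Metric.infDist (γ s) B :=
    ((Metric.continuous_infDist_pt A).comp hγc).sub ((Metric.continuous_infDist_pt B).comp hγc)
  have h0 : Metric.infDist (γ 0) A - Metric.infDist (γ 0) B ≤ 0 := by
    simp only [hγ, AffineMap.lineMap_apply_zero]; linarith
  have h1 : 0 ≤ Metric.infDist (γ 1) A - Metric.infDist (γ 1) B := by
    simp only [hγ, AffineMap.lineMap_apply_one, Metric.infDist_zero_of_mem hd, sub_zero]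
    exact Metric.infDist_nonneg
  obtain ⟨s, ⟨hs0, hs1⟩, hs⟩ := intermediate_value_Icc zero_le_one hcont.continuousOn ⟨h0, h1⟩
  refine ⟨γ s, sub_eq_zero.mp hs, ?_⟩
  rw [dist_left_lineMap, dist_lineMap_right, Real.norm_of_nonneg hs0,
    Real.norm_of_nonneg (sub_nonneg.mpr hs1)]
  ring

lemma lt_infDist_of_forall_lt {A : Set Plane} (hA : IsCompact A) (hne : A.Nonempty) {o : Plane}
    {r : ℝ} (h : ∀ y ∈ A, r < dist o y) : r < Metric.infDist o A := by
  obtain ⟨y, hy, hyd⟩ := hA.exists_infDist_eq_dist hne o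
  rw [hyd]
  exact h y hy

/-- Without a `K₄`, the Voronoi cells of two mutually visible regions share a point that lies in no
third cell. -/
lemma exists_equidistant_of_adj {V : Type*} [Finite V] {G : SimpleGraph V} {R : V → Set Plane}
    (hR : IsVisibilityRepresentation G R) (hcomp : ∀ i, IsCompact (R i))
    (hconv : ∀ i, Convex ℝ (R i))
    (hK : ¬ SimpleGraph.IsContained (⊤ : SimpleGraph (Fin 4)) G) {w z : V} (hwz : G.Adj w z) :
    ∃ m : Plane, Metric.infDist m (R w) = Metric.infDist m (R z) ∧
      ∀ i, i ≠ w → i ≠ z → Metric.infDist m (R w) < Metric.infDist m (R i) := by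
  obtain ⟨o, c, hc, d, hd, ho⟩ := exists_disc_of_adj hR hcomp hconv hK hwz
  have key : ∀ m x : Plane, ∀ r : ℝ, r ≤ dist m x → dist o m + dist m x = dist o x → ∀ i,
      (∀ y ∈ R i, dist o x < dist o y) → r < Metric.infDist m (R i) := by
    intro m x r hr hox i hi
    have h1 := lt_infDist_of_forall_lt (hcomp i) (hR.isConnected i).nonempty hi
    have h2 := Metric.infDist_le_infDist_add_dist (s := R i) (x := o) (y := m)
    linarith
  rcases le_total (Metric.infDist o (R w)) (Metric.infDist o (R z)) with hle | hle
  · obtain ⟨m, hm, hom⟩ := exists_infDist_eq_of_le hd hle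
    exact ⟨m, hm, fun i hiw hiz => key m d _ (hm ▸ Metric.infDist_le_dist_of_mem hd) hom i
      fun y hy => (ho i hiw hiz y hy).2⟩
  · obtain ⟨m, hm, hom⟩ := exists_infDist_eq_of_le hc hle
    exact ⟨m, hm.symm, fun i hiw hiz => key m c _ (Metric.infDist_le_dist_of_mem hc) hom i
      fun y hy => (ho i hiw hiz y hy).1⟩

/-! ### Simple arcs inside Voronoi cells -/

/-- `S` is a simple arc from `a` to `b`. -/
def IsArc (a b : Plane) (S : Set Plane) : Prop :=
  ∃ γ : Path a b, Function.Injective γ ∧ Set.range γ = S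

lemma isArc_segment {a b : Plane} (h : a ≠ b) : IsArc a b (segment ℝ a b) := by
  refine ⟨⟨⟨fun s : unitInterval => AffineMap.lineMap a b (s : ℝ), ?_⟩, by simp, by simp⟩, ?_, ?_⟩
  · exact AffineMap.lineMap_continuous.comp continuous_subtype_val
  · intro s s' hss
    exact Subtype.ext (AffineMap.lineMap_injective ℝ h hss)
  · rw [segment_eq_image_lineMap]
    ext x
    simp only [Set.mem_range, Set.mem_image]
    exact ⟨fun ⟨s, hs⟩ => ⟨s, s.2, hs⟩, fun ⟨s, hs, hx⟩ => ⟨⟨s, hs⟩, hx⟩⟩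

lemma IsArc.symm {a b : Plane} {S : Set Plane} (h : IsArc a b S) : IsArc b a S := by
  obtain ⟨γ, hγ, rfl⟩ := h
  refine ⟨γ.symm, fun s s' hs => ?_, γ.symm_range⟩
  exact unitInterval.symm_involutive.injective (hγ hs)

lemma IsArc.trans {a b c : Plane} {S S' : Set Plane} (h : IsArc a b S) (h' : IsArc b c S')
    (hinter : S ∩ S' ⊆ {b}) : IsArc a c (S ∪ S') := by
  obtain ⟨γ, hγ, rfl⟩ := h
  obtain ⟨γ', hγ', rfl⟩ := h'
  refine ⟨γ.trans γ', ?_, γ.trans_range γ'⟩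
  -- a value on both halves is `b`, which the second half takes only at its initial time
  have cross_ne : ∀ s t : unitInterval, γ s = γ' t → t = 0 := by
    intro s t hst
    have : γ' t = b := hinter ⟨⟨s, hst⟩, ⟨t, rfl⟩⟩
    exact hγ' (this.trans γ'.source.symm)
  intro s t hst
  rw [Path.trans_apply, Path.trans_apply] at hst
  split_ifs at hst with h1 h2 h2
  · have := congrArg Subtype.val (hγ hst)
    exact Subtype.ext (by simpa using this)
  · have := congrArg Subtype.val (cross_ne _ _ hst)
    simp only [Set.Icc.coe_zero] at this
    linarith
  · have := congrArg Subtype.val (cross_ne _ _ hst.symm)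
    simp only [Set.Icc.coe_zero] at this
    linarith
  · have := congrArg Subtype.val (hγ' hst)
    exact Subtype.ext (by simpa using this)

/-- The point of the segment from `f` to `m` at distance `ε` from `f`. -/
noncomputable def exitPoint (f m : Plane) (ε : ℝ) : Plane :=
  (1 - ε / dist m f) • f + (ε / dist m f) • m

/-- A polygonal line from a point `c` of a convex region to a point `m` outside it: from `c`
straight to the point at distance `ε` above the point `f` of the region nearest to `m`, then
straight to `m`. -/
noncomputable def halfArc (c f m : Plane) (ε : ℝ) : Set Plane :=
  segment ℝ c (exitPoint f m ε) ∪ segment ℝ (exitPoint f m ε) m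

lemma dist_combo_left (f m : Plane) {τ : ℝ} (h0 : 0 ≤ τ) :
    dist ((1 - τ) • f + τ • m) f = τ * dist m f := by
  rw [dist_eq_norm, dist_eq_norm, show (1 - τ) • f + τ • m - f = τ • (m - f) by module, norm_smul,
    Real.norm_of_nonneg h0]

lemma dist_combo_right (f m : Plane) {τ : ℝ} (h1 : τ ≤ 1) :
    dist m ((1 - τ) • f + τ • m) = (1 - τ) * dist m f := by
  rw [dist_eq_norm, dist_eq_norm, show m - ((1 - τ) • f + τ • m) = (1 - τ) • (m - f) by module,
    norm_smul, Real.norm_of_nonneg (by linarith)]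

/-- The distance to a set grows linearly along the segment from a nearest point. -/
lemma infDist_combo {C : Set Plane} {f m : Plane} (hf : f ∈ C)
    (hfm : Metric.infDist m C = dist m f) {τ : ℝ} (h0 : 0 ≤ τ) (h1 : τ ≤ 1) :
    Metric.infDist ((1 - τ) • f + τ • m) C = τ * dist m f := by
  apply le_antisymm
  · rw [← dist_combo_left f m h0]
    exact Metric.infDist_le_dist_of_mem hf
  · have := Metric.infDist_le_infDist_add_dist (s := C) (x := m) (y := (1 - τ) • f + τ • m)
    rw [dist_combo_right f m h1] at this
    linarith

lemma infDist_combo_le {C : Set Plane} (hC : IsCompact C) (hconv : Convex ℝ C) {c y : Plane}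
    (hc : c ∈ C) {a : ℝ} (h0 : 0 ≤ a) (h1 : a ≤ 1) :
    Metric.infDist ((1 - a) • c + a • y) C ≤ a * Metric.infDist y C := by
  obtain ⟨g, hg, hgd⟩ := hC.exists_infDist_eq_dist ⟨c, hc⟩ y
  have hmem := hconv.segment_subset hc hg (combo_mem_segment h0 h1)
  refine (Metric.infDist_le_dist_of_mem hmem).trans_eq ?_
  rw [hgd, dist_eq_norm, dist_eq_norm,
    show (1 - a) • c + a • y - ((1 - a) • c + a • g) = a • (y - g) by module, norm_smul,
    Real.norm_of_nonneg h0]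

lemma eq_of_dist_eq_infDist {C : Set Plane} (hconv : Convex ℝ C) {x f g : Plane} (hf : f ∈ C)
    (hg : g ∈ C) (hxf : Metric.infDist x C = dist x f) (hxg : Metric.infDist x C = dist x g) :
    f = g := by
  have hmid := hconv.segment_subset hf hg
    (combo_mem_segment (a := 1 / 2) (by norm_num) (by norm_num))
  have h1 := Metric.infDist_le_dist_of_mem (x := x) hmid
  rw [dist_eq_norm, show x - ((1 - 1 / 2 : ℝ) • f + (1 / 2 : ℝ) • g) =
    (1 / 2 : ℝ) • ((x - f) + (x - g)) by module, norm_smul] at h1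
  rw [dist_eq_norm] at hxf hxg
  have h2 := parallelogram_law_with_norm ℝ (x - f) (x - g)
  rw [← hxf, ← hxg] at h2
  have h0 : 0 ≤ Metric.infDist x C := Metric.infDist_nonneg
  norm_num at h1
  have h3 : ‖x - f - (x - g)‖ = 0 := by
    nlinarith [norm_nonneg (x - f - (x - g)), norm_nonneg (x - f + (x - g))]
  have h4 := norm_eq_zero.mp h3
  have : g - f = 0 := by rw [← h4]; abel
  exact (sub_eq_zero.mp this).symm

/-- The half-open segment from the nearest point `f` of `C` to `m` stays strictly closer to `C`
than to any set `D` that is disjoint from `C` and not closer to `m`. -/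
lemma infDist_combo_lt {C D : Set Plane} (hD : IsCompact D) (hDne : D.Nonempty)
    (hCD : Disjoint C D) {f m : Plane} (hf : f ∈ C) (hfm : Metric.infDist m C = dist m f)
    (hle : Metric.infDist m C ≤ Metric.infDist m D) {τ : ℝ} (h0 : 0 ≤ τ) (h1 : τ < 1) :
    Metric.infDist ((1 - τ) • f + τ • m) C < Metric.infDist ((1 - τ) • f + τ • m) D := by
  rw [infDist_combo hf hfm h0 h1.le]
  apply lt_infDist_of_forall_lt hD hDne
  intro g hg
  by_contra hlt
  push Not at hlt
  have hmg : dist m f ≤ dist m g := by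
    rw [← hfm]; exact hle.trans (Metric.infDist_le_dist_of_mem hg)
  rw [dist_eq_norm, dist_eq_norm, show (1 - τ) • f + τ • m - g =
    (m - g) - (1 - τ) • (m - f) by module] at hlt
  rw [dist_eq_norm, dist_eq_norm] at hmg
  have e1 := norm_sub_sq_real (m - g) ((1 - τ) • (m - f))
  rw [real_inner_smul_right, norm_smul, Real.norm_of_nonneg (by linarith : (0 : ℝ) ≤ 1 - τ)] at e1
  have e2 := norm_sub_sq_real (m - g) (m - f)
  have e3 := pow_le_pow_left₀ (norm_nonneg _) hlt 2
  have e4 := pow_le_pow_left₀ (norm_nonneg _) hmg 2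
  have e5 : (1 - τ) * ‖m - g - (m - f)‖ ^ 2 ≤ 0 := by
    have e6 : (1 - τ) * ‖m - g - (m - f)‖ ^ 2 =
        ‖m - g - (1 - τ) • (m - f)‖ ^ 2 - (τ * ‖m - f‖) ^ 2
          - τ * (‖m - g‖ ^ 2 - ‖m - f‖ ^ 2) := by
      rw [e1, e2]; ring
    rw [e6]
    have := mul_nonneg h0 (sub_nonneg.mpr e4)
    linarith
  have e7 : ‖m - g - (m - f)‖ = 0 := by
    have : ‖m - g - (m - f)‖ ^ 2 ≤ 0 := by
      by_contra hn
      have := mul_pos (sub_pos.mpr h1) (not_le.mp hn)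
      linarith
    nlinarith [norm_nonneg (m - g - (m - f))]
  have e8 := norm_eq_zero.mp e7
  have : f = g := by
    have : f - g = 0 := by rw [← e8]; abel
    exact sub_eq_zero.mp this
  exact Set.disjoint_left.mp hCD hf (this ▸ hg)

lemma exists_combo_of_mem_segment_exitPoint {f m x : Plane} {ε : ℝ} (hε : 0 < ε)
    (hm : ε < dist m f) (hx : x ∈ segment ℝ (exitPoint f m ε) m) :
    ∃ τ, ε / dist m f ≤ τ ∧ τ ≤ 1 ∧ x = (1 - τ) • f + τ • m := by
  obtain ⟨a, ha0, ha1, rfl⟩ := exists_combo_of_mem_segment hx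
  have hd : 0 < dist m f := hε.trans hm
  have h1 : ε / dist m f ≤ 1 := (div_le_one hd).mpr hm.le
  refine ⟨(1 - a) * (ε / dist m f) + a, ?_, ?_, ?_⟩
  · nlinarith
  · nlinarith
  · simp only [exitPoint]; module

lemma infDist_exitPoint {C : Set Plane} {f m : Plane} (hf : f ∈ C)
    (hfm : Metric.infDist m C = dist m f) {ε : ℝ} (hε : 0 < ε) (hm : ε < dist m f) :
    Metric.infDist (exitPoint f m ε) C = ε := by
  have hd : 0 < dist m f := hε.trans hm
  rw [exitPoint, infDist_combo hf hfm (by positivity) ((div_le_one hd).mpr hm.le),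
    div_mul_cancel₀ _ hd.ne']

lemma isArc_halfArc {C : Set Plane} (hC : IsCompact C) (hconv : Convex ℝ C) {c f m : Plane}
    (hc : c ∈ C) (hf : f ∈ C) (hfm : Metric.infDist m C = dist m f) {ε : ℝ} (hε : 0 < ε)
    (hm : ε < dist m f) : IsArc c m (halfArc c f m ε) := by
  have hy := infDist_exitPoint hf hfm hε hm
  have hd : 0 < dist m f := hε.trans hm
  refine (isArc_segment ?_).trans (isArc_segment ?_) ?_
  · intro h
    rw [← h, Metric.infDist_zero_of_mem hc] at hy
    exact hε.ne hy
  · intro h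
    rw [h, hfm] at hy
    exact hm.ne' hy
  · rintro x ⟨hx, hx'⟩
    obtain ⟨a, ha0, ha1, rfl⟩ := exists_combo_of_mem_segment hx
    obtain ⟨τ, hτ, hτ1, hxτ⟩ := exists_combo_of_mem_segment_exitPoint hε hm hx'
    have hτ0 : 0 ≤ τ := le_trans (by positivity) hτ
    have h1 := infDist_combo_le hC hconv (y := exitPoint f m ε) hc ha0 ha1
    rw [hxτ, infDist_combo hf hfm hτ0 hτ1, hy] at h1
    rw [div_le_iff₀ hd] at hτ
    have ha : a = 1 := by
      by_contra hne
      have := lt_of_le_of_ne ha1 hne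
      nlinarith
    rw [ha]
    simp

/-- Two half arcs in the same region towards different points, neither of which lies on the
normal segment of the other, meet only at the centre. -/
lemma halfArc_inter_subset {C : Set Plane} (hC : IsCompact C) (hconv : Convex ℝ C)
    {c f m f' m' : Plane} (hc : c ∈ C) (hf : f ∈ C) (hfm : Metric.infDist m C = dist m f)
    (hf' : f' ∈ C) (hfm' : Metric.infDist m' C = dist m' f') {ε : ℝ} (hε : 0 < ε)
    (hm : ε < dist m f) (hm' : ε < dist m' f')
    (hne : ∀ τ : ℝ, 0 ≤ τ → τ ≤ 1 → (1 - τ) • f + τ • m ≠ m')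
    (hne' : ∀ τ : ℝ, 0 ≤ τ → τ ≤ 1 → (1 - τ) • f' + τ • m' ≠ m) :
    halfArc c f m ε ∩ halfArc c f' m' ε ⊆ {c} := by
  have hd : 0 < dist m f := hε.trans hm
  have hd' : 0 < dist m' f' := hε.trans hm'
  have hy := infDist_exitPoint hf hfm hε hm
  have hy' := infDist_exitPoint hf' hfm' hε hm'
  -- the outer segments lie on normals of `C`; a common point has a unique nearest point in `C`
  have outer : ∀ x, x ∈ segment ℝ (exitPoint f m ε) m →
      x ∈ segment ℝ (exitPoint f' m' ε) m' → False := by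
    intro x hx hx'
    obtain ⟨τ, hτ, hτ1, hxτ⟩ := exists_combo_of_mem_segment_exitPoint hε hm hx
    obtain ⟨τ', hτ', hτ1', hxτ'⟩ := exists_combo_of_mem_segment_exitPoint hε hm' hx'
    have hτ0 : 0 < τ := lt_of_lt_of_le (by positivity) hτ
    have hτ0' : 0 < τ' := lt_of_lt_of_le (by positivity) hτ'
    have e1 : Metric.infDist x C = dist x f := by
      rw [hxτ, infDist_combo hf hfm hτ0.le hτ1, dist_combo_left f m hτ0.le]
    have e2 : Metric.infDist x C = dist x f' := by
      rw [hxτ', infDist_combo hf' hfm' hτ0'.le hτ1', dist_combo_left f' m' hτ0'.le]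
    obtain rfl := eq_of_dist_eq_infDist hconv hf hf' e1 e2
    have e3 : τ • (m - f) = τ' • (m' - f) := by
      have := hxτ.symm.trans hxτ'
      have e : (1 - τ) • f + τ • m - f = (1 - τ') • f + τ' • m' - f := by rw [this]
      calc τ • (m - f) = (1 - τ) • f + τ • m - f := by module
        _ = _ := e
        _ = τ' • (m' - f) := by module
    rcases le_total τ τ' with h | h
    · refine hne (τ / τ') (by positivity) ((div_le_one hτ0').mpr h) ?_
      calc (1 - τ / τ') • f + (τ / τ') • m = f + τ'⁻¹ • (τ • (m - f)) := by
            rw [div_eq_inv_mul]; module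
        _ = f + (τ'⁻¹ * τ') • (m' - f) := by rw [e3, smul_smul]
        _ = m' := by rw [inv_mul_cancel₀ hτ0'.ne']; module
    · refine hne' (τ' / τ) (by positivity) ((div_le_one hτ0).mpr h) ?_
      calc (1 - τ' / τ) • f + (τ' / τ) • m' = f + τ⁻¹ • (τ' • (m' - f)) := by
            rw [div_eq_inv_mul]; module
        _ = f + (τ⁻¹ * τ) • (m - f) := by rw [← e3, smul_smul]
        _ = m := by rw [inv_mul_cancel₀ hτ0.ne']; module
  -- on the inner segment only the exit point has distance `ε`
  have inner_outer : ∀ {g n g' n' x : Plane}, Metric.infDist (exitPoint g n ε) C = ε →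
      g' ∈ C → Metric.infDist n' C = dist n' g' → ε < dist n' g' →
      x ∈ segment ℝ c (exitPoint g n ε) → x ∈ segment ℝ (exitPoint g' n' ε) n' →
      x ∈ segment ℝ (exitPoint g n ε) n := by
    intro g n g' n' x hyg hg' hgn' hn' hx hx'
    have hdn : 0 < dist n' g' := hε.trans hn'
    obtain ⟨a, ha0, ha1, rfl⟩ := exists_combo_of_mem_segment hx
    obtain ⟨τ, hτ, hτ1, hxτ⟩ := exists_combo_of_mem_segment_exitPoint hε hn' hx'
    have hτ0 : 0 ≤ τ := le_trans (by positivity) hτ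
    have h1 := infDist_combo_le hC hconv (y := exitPoint g n ε) hc ha0 ha1
    rw [hxτ, infDist_combo hg' hgn' hτ0 hτ1, hyg] at h1
    rw [div_le_iff₀ hdn] at hτ
    have ha : a = 1 := by
      by_contra hne
      have := lt_of_le_of_ne ha1 hne
      nlinarith
    rw [ha]
    simpa using left_mem_segment ℝ (exitPoint g n ε) n
  -- on a common ray from `c` the two exit points coincide
  have inner : ∀ {y y' : Plane} {a b : ℝ}, Metric.infDist y C = ε → Metric.infDist y' C = ε →
      0 < a → a ≤ b → (1 - a) • c + a • y = (1 - b) • c + b • y' → y = y' := by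
    intro y y' a b hy hy' ha hab h
    have hb : 0 < b := ha.trans_le hab
    have e1 : a • (y - c) = b • (y' - c) := by
      calc a • (y - c) = (1 - a) • c + a • y - c := by module
        _ = (1 - b) • c + b • y' - c := by rw [h]
        _ = b • (y' - c) := by module
    have e2 : y' = (1 - a / b) • c + (a / b) • y := by
      symm
      calc (1 - a / b) • c + (a / b) • y = c + b⁻¹ • (a • (y - c)) := by
            rw [div_eq_inv_mul]; module
        _ = c + (b⁻¹ * b) • (y' - c) := by rw [e1, smul_smul]
        _ = y' := by rw [inv_mul_cancel₀ hb.ne']; module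
    have e3 := infDist_combo_le hC hconv (y := y) hc (a := a / b) (by positivity)
      ((div_le_one hb).mpr hab)
    rw [← e2, hy, hy'] at e3
    have e4 : 1 ≤ a / b := by
      by_contra hn
      nlinarith
    have e5 : a / b = 1 := le_antisymm ((div_le_one hb).mpr hab) e4
    rw [e2, e5]
    simp
  rintro x ⟨hx | hx, hx' | hx'⟩
  · obtain ⟨a, ha0, ha1, hxa⟩ := exists_combo_of_mem_segment hx
    obtain ⟨b, hb0, hb1, hxb⟩ := exists_combo_of_mem_segment hx'
    rcases ha0.eq_or_lt with rfl | ha0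
    · simpa using hxa
    rcases hb0.eq_or_lt with rfl | hb0
    · simpa using hxb
    have hyy : exitPoint f m ε = exitPoint f' m' ε := by
      rcases le_total a b with h | h
      · exact inner hy hy' ha0 h (hxa.symm.trans hxb)
      · exact (inner hy' hy hb0 h (hxb.symm.trans hxa)).symm
    exact (outer _ (left_mem_segment ℝ _ _) (hyy ▸ left_mem_segment ℝ _ _)).elim
  · exact (outer x (inner_outer hy hf' hfm' hm' hx hx') hx').elim
  · exact (outer x hx (inner_outer hy' hf hfm hm hx' hx)).elim
  · exact (outer x hx hx').elim

/-! ### The drawing dual to the Voronoi diagram -/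

lemma exists_separation {V : Type*} [Finite V] {R : V → Set Plane}
    (hne : ∀ i, (R i).Nonempty) (hcomp : ∀ i, IsCompact (R i))
    (hdisj : ∀ i j, i ≠ j → Disjoint (R i) (R j)) :
    ∃ ε > 0, ∀ i j, i ≠ j → ∀ x ∈ R i, ∀ y ∈ R j, 2 * ε < dist x y := by
  have hpair : ∀ P : V × V, ∃ δ > 0, P.1 ≠ P.2 → ∀ x ∈ R P.1, ∀ y ∈ R P.2, δ ≤ dist x y := by
    rintro ⟨i, j⟩
    by_cases hij : i = j
    · exact ⟨1, one_pos, fun h => absurd hij h⟩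
    obtain ⟨⟨x₀, y₀⟩, ⟨hx₀, hy₀⟩, hmin⟩ := ((hcomp i).prod (hcomp j)).exists_isMinOn
      ((hne i).prod (hne j)) (f := fun p => dist p.1 p.2) continuous_dist.continuousOn
    refine ⟨dist x₀ y₀, dist_pos.mpr fun h => ?_, fun _ x hx y hy => ?_⟩
    · have h' : x₀ = y₀ := h
      exact Set.disjoint_left.mp (hdisj i j hij) hx₀ (h' ▸ hy₀)
    · exact isMinOn_iff.mp hmin (x, y) ⟨hx, hy⟩
  choose δ hδ hδR using hpair
  rcases isEmpty_or_nonempty V with hV | hV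
  · exact ⟨1, one_pos, fun i => (hV.false i).elim⟩
  · obtain ⟨P₀, hP₀⟩ := Finite.exists_min δ
    refine ⟨δ P₀ / 3, by linarith [hδ P₀], fun i j hij x hx y hy => ?_⟩
    have := hδR (i, j) hij x hx y hy
    linarith [hδ P₀, hP₀ (i, j)]

/-- If for every edge there is a point whose nearest regions are exactly those of the two ends,
the graph is planar: the half arcs from the regions to these points are drawn inside the Voronoi
cells of the regions. -/
theorem isPlanarGraph_of_equidistant {V : Type*} [Finite V] {G : SimpleGraph V}
    {R : V → Set Plane} (hne : ∀ i, (R i).Nonempty) (hcomp : ∀ i, IsCompact (R i))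
    (hconv : ∀ i, Convex ℝ (R i)) (hdisj : ∀ i j, i ≠ j → Disjoint (R i) (R j))
    (h : ∀ e ∈ G.edgeSet, ∃ (m : Plane) (ρ : ℝ), (∀ u ∈ e, Metric.infDist m (R u) = ρ) ∧
      ∀ i, i ∉ e → ρ < Metric.infDist m (R i)) :
    IsPlanarGraph G := by
  obtain ⟨ε, hε, hsep⟩ := exists_separation hne hcomp hdisj
  choose c hc using hne
  choose! m ρ hmρ hmi using h
  choose f hf hfd using fun u x => (hcomp u).exists_infDist_eq_dist ⟨c u, hc u⟩ x
  have hmem : ∀ e ∈ G.edgeSet, ∃ a b, a ≠ b ∧ e = s(a, b) := by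
    intro e he
    induction e using Sym2.ind with
    | _ a b => exact ⟨a, b, G.ne_of_adj he, rfl⟩
  have hρ : ∀ e ∈ G.edgeSet, ε < ρ e := by
    intro e he
    obtain ⟨a, b, hab, heq⟩ := hmem e he
    have h1 := hsep a b hab _ (hf a (m e)) _ (hf b (m e))
    have h2 := dist_triangle_left (f a (m e)) (f b (m e)) (m e)
    rw [← hfd, ← hfd, hmρ e he a (heq ▸ Sym2.mem_mk_left a b),
      hmρ e he b (heq ▸ Sym2.mem_mk_right a b)] at h2
    linarith
  have hdist : ∀ e ∈ G.edgeSet, ∀ u ∈ e, ε < dist (m e) (f u (m e)) := by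
    intro e he u hu
    rw [← hfd, hmρ e he u hu]
    exact hρ e he
  -- no centre of an edge lies in an open Voronoi cell
  have hcentre : ∀ e ∈ G.edgeSet, ∀ i,
      ¬ ∀ j, j ≠ i → Metric.infDist (m e) (R i) < Metric.infDist (m e) (R j) := by
    intro e he i hi
    obtain ⟨a, b, hab, heq⟩ := hmem e he
    have hma := hmρ e he a (heq ▸ Sym2.mem_mk_left a b)
    have hmb := hmρ e he b (heq ▸ Sym2.mem_mk_right a b)
    by_cases hie : i ∈ e
    · have hmi := hmρ e he i hie
      rw [heq, Sym2.mem_iff] at hie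
      rcases hie with rfl | rfl
      · have := hi b hab.symm
        linarith
      · have := hi a hab
        linarith
    · have h1 := hmi e he i hie
      have h2 := hi a fun h => hie (h ▸ heq ▸ Sym2.mem_mk_left a b)
      linarith
  have hnormal : ∀ e ∈ G.edgeSet, ∀ u ∈ e, ∀ τ : ℝ, 0 ≤ τ → τ < 1 → ∀ j, j ≠ u →
      Metric.infDist ((1 - τ) • f u (m e) + τ • m e) (R u) <
        Metric.infDist ((1 - τ) • f u (m e) + τ • m e) (R j) := by
    intro e he u hu τ h0 h1 j hj
    refine infDist_combo_lt (hcomp j) ⟨c j, hc j⟩ (hdisj u j hj.symm) (hf u _) (hfd u _) ?_ h0 h1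
    rw [hmρ e he u hu]
    by_cases hje : j ∈ e
    · exact (hmρ e he j hje).ge
    · exact (hmi e he j hje).le
  set H : Sym2 V → V → Set Plane := fun e u => halfArc (c u) (f u (m e)) (m e) ε with hH
  have hcell : ∀ e ∈ G.edgeSet, ∀ u ∈ e, ∀ x ∈ H e u, x ≠ m e →
      ∀ j, j ≠ u → Metric.infDist x (R u) < Metric.infDist x (R j) := by
    intro e he u hu x hx hxm j hj
    rcases hx with hx | hx
    · obtain ⟨a, ha0, ha1, rfl⟩ := exists_combo_of_mem_segment hx
      have h1 := infDist_combo_le (hcomp u) (hconv u) (y := exitPoint (f u (m e)) (m e) ε)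
        (hc u) ha0 ha1
      rw [infDist_exitPoint (hf u _) (hfd u _) hε (hdist e he u hu)] at h1
      set x := (1 - a) • c u + a • exitPoint (f u (m e)) (m e) ε
      have h2 := hsep u j hj.symm _ (hf u x) _ (hf j x)
      have h3 := dist_triangle_left (f u x) (f j x) x
      rw [← hfd, ← hfd] at h3
      nlinarith
    · obtain ⟨τ, hτ, hτ1, rfl⟩ := exists_combo_of_mem_segment_exitPoint hε (hdist e he u hu) hx
      have hτ0 : 0 ≤ τ := le_trans (div_nonneg hε.le dist_nonneg) hτ
      rcases hτ1.eq_or_lt with rfl | hτ1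
      · simp at hxm
      · exact hnormal e he u hu τ hτ0 hτ1 j hj
  have hsame : ∀ e ∈ G.edgeSet, ∀ u ∈ e, ∀ v ∈ e, u ≠ v → H e u ∩ H e v ⊆ {m e} := by
    rintro e he u hu v hv huv x ⟨hx, hx'⟩
    by_contra hxm
    exact lt_asymm (hcell e he u hu x hx hxm v huv.symm) (hcell e he v hv x hx' hxm u huv)
  refine ⟨c, fun e => ⋃ u ∈ {u | u ∈ e}, H e u, ⟨?_, ?_, ?_, ?_⟩⟩
  · intro u v huv
    by_contra hne
    exact Set.disjoint_left.mp (hdisj u v hne) (hc u) (huv ▸ hc v)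
  · intro u v huv
    have he : s(u, v) ∈ G.edgeSet := huv
    have harc : ∀ x ∈ s(u, v), IsArc (c x) (m s(u, v)) (H s(u, v) x) := fun x hx =>
      isArc_halfArc (hcomp x) (hconv x) (hc x) (hf x _) (hfd x _) hε (hdist _ he x hx)
    have hu := Sym2.mem_mk_left u v
    have hv := Sym2.mem_mk_right u v
    have := (harc u hu).trans (harc v hv).symm (hsame _ he u hu v hv huv.ne)
    have hU : (⋃ x ∈ {x | x ∈ s(u, v)}, H s(u, v) x) = H s(u, v) u ∪ H s(u, v) v := by
      ext x; simp
    rw [hU]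
    exact this
  · intro e he w hw
    simp only [Set.mem_iUnion, Set.mem_ofPred_eq] at hw
    obtain ⟨u, hu, hw⟩ := hw
    have hw0 := Metric.infDist_zero_of_mem (hc w)
    by_cases hcm : c w = m e
    · by_contra hwe
      have := hmi e he w hwe
      rw [← hcm, hw0] at this
      linarith [hρ e he]
    · by_contra hwe
      have := hcell e he u hu _ hw hcm w fun h => hwe (h ▸ hu)
      rw [hw0] at this
      exact absurd this (not_lt.mpr Metric.infDist_nonneg)
  · rintro e he e' he' hee x ⟨hx, hx'⟩
    simp only [Set.mem_iUnion, Set.mem_ofPred_eq] at hx hx'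
    obtain ⟨u, hu, hx⟩ := hx
    obtain ⟨u', hu', hx'⟩ := hx'
    -- the centre determines the edge
    have hmm : m e ≠ m e' := by
      intro hmm
      apply hee
      have hsub : ∀ e₁ ∈ G.edgeSet, ∀ e₂ ∈ G.edgeSet, m e₁ = m e₂ → ∀ i ∈ e₁, i ∈ e₂ := by
        intro e₁ h₁ e₂ h₂ h12 i hi
        by_contra hi2
        obtain ⟨a, b, hab, heq⟩ := hmem e₂ h₂
        have e1 := hmi e₂ h₂ i hi2
        have e2 := hmρ e₂ h₂ a (heq ▸ Sym2.mem_mk_left a b)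
        rw [← h12] at e1 e2
        rw [hmρ e₁ h₁ i hi] at e1
        by_cases ha : a ∈ e₁
        · rw [hmρ e₁ h₁ a ha] at e2
          linarith
        · have := hmi e₁ h₁ a ha
          linarith
      obtain ⟨a, b, hab, heq⟩ := hmem e he
      have ha := hsub e he e' he' hmm a (heq ▸ Sym2.mem_mk_left a b)
      have hb := hsub e he e' he' hmm b (heq ▸ Sym2.mem_mk_right a b)
      rw [heq]
      exact ((Sym2.mem_and_mem_iff hab).mp ⟨ha, hb⟩).symm
    have hxm : x ≠ m e := by
      rintro rfl
      exact hcentre e he u' (hcell e' he' u' hu' _ hx' hmm)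
    have hxm' : x ≠ m e' := by
      rintro rfl
      exact hcentre e' he' u (hcell e he u hu _ hx hmm.symm)
    have huu : u = u' := by
      by_contra huu
      exact lt_asymm (hcell e he u hu x hx hxm u' (Ne.symm huu))
        (hcell e' he' u' hu' x hx' hxm' u huu)
    subst huu
    have hoff : ∀ e₁ ∈ G.edgeSet, ∀ e₂ ∈ G.edgeSet, m e₁ ≠ m e₂ → u ∈ e₁ → ∀ τ : ℝ, 0 ≤ τ →
        τ ≤ 1 → (1 - τ) • f u (m e₁) + τ • m e₁ ≠ m e₂ := by
      intro e₁ h₁ e₂ h₂ h12 hu₁ τ h0 h1 heq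
      rcases h1.eq_or_lt with rfl | h1
      · apply h12
        simpa using heq
      · have := hnormal e₁ h₁ u hu₁ τ h0 h1
        rw [heq] at this
        exact hcentre e₂ h₂ u this
    have := halfArc_inter_subset (hcomp u) (hconv u) (hc u) (hf u _) (hfd u _) (hf u _) (hfd u _)
      hε (hdist e he u hu) (hdist e' he' u hu') (hoff e he e' he' hmm hu)
      (hoff e' he' e he hmm.symm hu') ⟨hx, hx'⟩
    exact ⟨u, hu, hu', this.symm⟩

theorem mainTheorem4 {V : Type*} [Finite V] (G : SimpleGraph V)
    (hG : IsConvexCompactVisibilityGraph G) :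
    IsPlanarGraph G ∨ SimpleGraph.IsContained (⊤ : SimpleGraph (Fin 4)) G := by
  obtain ⟨R, hR, hcomp, hconv⟩ := hG
  by_cases hK : SimpleGraph.IsContained (⊤ : SimpleGraph (Fin 4)) G
  · exact Or.inr hK
  refine Or.inl (isPlanarGraph_of_equidistant (fun i => (hR.isConnected i).nonempty) hcomp hconv
    hR.disjoint fun e he => ?_)
  induction e using Sym2.ind with
  | _ w z =>
    obtain ⟨m, hm, hmi⟩ := exists_equidistant_of_adj hR hcomp hconv hK (w := w) (z := z) he
    refine ⟨m, Metric.infDist m (R w), fun u hu => ?_, fun i hi => ?_⟩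
    · rcases Sym2.mem_iff.mp hu with rfl | rfl
      · rfl
      · exact hm.symm
    · rw [Sym2.mem_iff, not_or] at hi
      exact hmi i hi.1 hi.2
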